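/- For sequences $x=(x_n)_{n\ge1}$, $y=(y_n)_{n\ge1}$ in $[-1,1]$ put $D(x,y)=\sup_{n\ge1}2^{-n}|x_n-y_n|$, and let $\sigma\colon[-1,1]^{\mathbb N}\to[-1,1]^{\mathbb N}$, $\sigma(x)_n=x_{n+1}$, be the shift. Let $(s_k)_{k\ge1}$ be any sequence of real numbers with $0<s_1<s_2<\cdots$ and $\lim_{k\to\infty}s_k=1$, and put \[ S=\{-1,1\}\cup\{-s_k\colon k\ge1\}\cup\{s_k\colon k\ge1\}. \] Let $X$ be the set of all $x=(x_n)_{n\ge1}\in S^{\mathbb N}$ such that (i) $|x_1|\le|x_2|\le\cdots$; (ii) for all $n,k\ge1$, if $x_n=s_k$, then $x_{n+j}=-s_k$ for all $1\le j\le k$; (iii) for all $n\ge1$, if $x_n=1$, then $x_{n+j}=-1$ for all $j\ge1$. Then $\sigma(X)\subset X$, the set $X$ is compact with respect to $D$, the map $f=\sigma|_X\colon X\to X$ is continuous, and $f$ has the s-limit shadowing property: for every $\epsilon>0$ there is $\delta>0$ such that for every sequence $(\xi_i)_{i\ge0}$ in $X$ with $D(f(\xi_i),\xi_{i+1})\le\delta$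 for all $i\ge0$ and $\lim_{i\to\infty}D(f(\xi_i),\xi_{i+1})=0$ there is $x\in X$ with $D(f^i(x),\xi_i)\le\epsilon$ for all $i\ge0$ and $\lim_{i\to\infty}D(f^i(x),\xi_i)=0$. -/

import Mathlib

open Filter Topology

noncomputable section

namespace SLimit

/-! ### s-limit shadowing -/

section Shadowing

variable {Y : Type*} [MetricSpace Y]

/-- `ξ` is a `δ`-limit-pseudo orbit of `f`. -/
def IsLimitPseudoOrbit (f : Y → Y) (δ : ℝ) (ξ : ℕ → Y) : Prop :=
  (∀ i, dist (f (ξ i)) (ξ (i + 1)) ≤ δ) ∧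
    Tendsto (fun i => dist (f (ξ i)) (ξ (i + 1))) atTop (𝓝 0)

/-- `ξ` is `ε`-limit shadowed by the point `x`. -/
def IsLimitShadowedBy (f : Y → Y) (ε : ℝ) (ξ : ℕ → Y) (x : Y) : Prop :=
  (∀ i, dist (f^[i] x) (ξ i) ≤ ε) ∧
    Tendsto (fun i => dist (f^[i] x) (ξ i)) atTop (𝓝 0)

/-- The s-limit shadowing property. -/
def HasSLimitShadowing (f : Y → Y) : Prop :=
  ∀ ε : ℝ, 0 < ε → ∃ δ : ℝ, 0 < δ ∧
    ∀ ξ : ℕ → Y, IsLimitPseudoOrbit f δ ξ → ∃ x : Y, IsLimitShadowedBy f ε ξ x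

end Shadowing

/-! ### The space `[-1,1]^ℕ` with its metric and its shift -/

/-- The space of sequences in `[-1,1]`. The coordinate `x_n`, `n ≥ 1`, of the mathematical text
is `x (n - 1)` here, so coordinates are numbered from `0`. -/
def SeqSpace : Type := ℕ → Set.Icc (-1 : ℝ) 1

/-- The coordinate of `x` at position `n` (numbered from `0`), as a real number. -/
def SeqSpace.coord (x : SeqSpace) (n : ℕ) : ℝ := (x n : Set.Icc (-1 : ℝ) 1)

/-- The distance `D(x,y) = sup_n 2^{-n} |x_n - y_n|`, `n ≥ 1`. With positions numbered from `0`,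
the weight at position `n` is `2^{-(n+1)}`. -/
def seqDist (x y : SeqSpace) : ℝ :=
  ⨆ n : ℕ, (1 / 2 : ℝ) ^ (n + 1) * |x.coord n - y.coord n|

theorem SeqSpace.abs_coord_sub_le (x y : SeqSpace) (n : ℕ) : |x.coord n - y.coord n| ≤ 2 := by
  have hx : -1 ≤ x.coord n ∧ x.coord n ≤ 1 := (x n).2
  have hy : -1 ≤ y.coord n ∧ y.coord n ≤ 1 := (y n).2
  rw [abs_le]
  constructor <;> linarith [hx.1, hx.2, hy.1, hy.2]

theorem seqDist_bddAbove (x y : SeqSpace) :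
    BddAbove (Set.range fun n : ℕ => (1 / 2 : ℝ) ^ (n + 1) * |x.coord n - y.coord n|) := by
  refine ⟨2, ?_⟩
  rintro _ ⟨n, rfl⟩
  have h1 : (1 / 2 : ℝ) ^ (n + 1) ≤ 1 := pow_le_one₀ (by norm_num) (by norm_num)
  have h2 := SeqSpace.abs_coord_sub_le x y n
  have h3 := abs_nonneg (x.coord n - y.coord n)
  change (1 / 2 : ℝ) ^ (n + 1) * |x.coord n - y.coord n| ≤ 2
  nlinarith

theorem le_seqDist (x y : SeqSpace) (n : ℕ) :
    (1 / 2 : ℝ) ^ (n + 1) * |x.coord n - y.coord n| ≤ seqDist x y :=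
  le_ciSup (seqDist_bddAbove x y) n

instance : MetricSpace SeqSpace where
  dist := seqDist
  dist_self x := by
    change seqDist x x = 0
    simp [seqDist]
  dist_comm x y := by
    change seqDist x y = seqDist y x
    simp only [seqDist, abs_sub_comm]
  dist_triangle x y z := by
    change seqDist x z ≤ seqDist x y + seqDist y z
    refine ciSup_le fun n => ?_
    have h1 := le_seqDist x y n
    have h2 := le_seqDist y z n
    have h3 : (1 / 2 : ℝ) ^ (n + 1) * |x.coord n - z.coord n| ≤
        (1 / 2 : ℝ) ^ (n + 1) * (|x.coord n - y.coord n| + |y.coord n - z.coord n|) :=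
      mul_le_mul_of_nonneg_left (abs_sub_le _ _ _) (by positivity)
    linarith
  eq_of_dist_eq_zero := by
    intro x y h
    change seqDist x y = 0 at h
    funext n
    have h1 := le_seqDist x y n
    rw [h] at h1
    have h2 : (0 : ℝ) < (1 / 2 : ℝ) ^ (n + 1) := by positivity
    have h3 : |x.coord n - y.coord n| ≤ 0 := by
      by_contra hc
      push Not at hc
      exact absurd h1 (not_le.mpr (mul_pos h2 hc))
    exact Subtype.ext (sub_eq_zero.mp (abs_nonpos_iff.mp h3))

/-- The shift map on `[-1,1]^ℕ`. -/
def shift (x : SeqSpace) : SeqSpace := fun n => x (n + 1)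

/-! ### The subshift -/

/-- The alphabet `S = {-1, 1} ∪ {-s_k : k ≥ 1} ∪ {s_k : k ≥ 1}`. -/
def alphabet (s : ℕ → ℝ) : Set ℝ :=
  {-1, 1} ∪ {a | ∃ k : ℕ, 1 ≤ k ∧ a = -s k} ∪ {a | ∃ k : ℕ, 1 ≤ k ∧ a = s k}

/-- The subshift `X ⊆ S^ℕ` attached to the sequence `s_1, s_2, …` (the value `s 0` is not used). -/
def subshift (s : ℕ → ℝ) : Set SeqSpace :=
  {x | (∀ n, x.coord n ∈ alphabet s) ∧
    (∀ n, |x.coord n| ≤ |x.coord (n + 1)|) ∧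
    (∀ n k : ℕ, 1 ≤ k → x.coord n = s k →
      ∀ j : ℕ, 1 ≤ j → j ≤ k → x.coord (n + j) = -s k) ∧
    (∀ n : ℕ, x.coord n = 1 → ∀ j : ℕ, 1 ≤ j → x.coord (n + j) = -1)}

theorem mapsTo_shift (s : ℕ → ℝ) : Set.MapsTo shift (subshift s) (subshift s) := by
  rintro x ⟨h1, h2, h3, h4⟩
  refine ⟨fun n => h1 (n + 1), fun n => h2 (n + 1), fun n k hk hn j hj hjk => ?_,
    fun n hn j hj => ?_⟩
  · have := h3 (n + 1) k hk hn j hj hjk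
    rwa [add_right_comm] at this
  · have := h4 (n + 1) hn j hj
    rwa [add_right_comm] at this

/-- The map `f = σ|_X : X → X`. -/
def subshiftMap (s : ℕ → ℝ) : subshift s → subshift s :=
  (mapsTo_shift s).restrict shift (subshift s) (subshift s)

end SLimit

end

/-! A point of the subshift is coded by signs and by levels in `ℕ∞`: level `k` stands for $s_{k+1}$
and `⊤` for $1$. The rules become: levels are nondecreasing, and a plus at level `k` is followed by
`k + 1` minuses at level `k`. These are closed conditions on a compact space, and decoding is
continuous, so the subshift is compact.

For shadowing, read off the sign and level of the initial coordinate of each $\xi_i$. Small errors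
force these to obey the rules after truncating levels at some `K` (`exists_approxAt`), and in the
tail at every `N`. In `exists_exact_levels` the signs are kept and only levels at least `K` are
altered, which moves a letter by at most $1 - s_{K+1}$. The new level is the minimum of the limiting
level `c` and the largest level that the later gaps between pluses allow. Since gaps far out are
nearly as long as `c` demands, the new levels are asymptotic to the old ones. -/

namespace SLimit

/-! ### Correcting approximate codes -/

/-- The pair of a sequence of signs `b` and a sequence of levels `l` obeys, at position `i` and up
to level `N`, the rules of the subshift. -/
def ApproxAt (b : ℕ → Prop) (l : ℕ → ℕ∞) (N : ℕ) (i : ℕ) : Prop :=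
  min (l i) N ≤ min (l (i + 1)) N ∧
    (b i → ∀ j : ℕ, 1 ≤ j → (j : ℕ∞) ≤ min (l i) N + 1 →
      ¬ b (i + j) ∧ min (l (i + j)) N = min (l i) N)

/-- The truncated levels of an eventually approximate code stabilise at the truncation of the
inferior limit of the levels. -/
theorem eventually_min_eq_liminf {b : ℕ → Prop} {l : ℕ → ℕ∞}
    (h : ∀ N, ∀ᶠ i in atTop, ApproxAt b l N i) (N : ℕ) :
    ∀ᶠ i in atTop, min (l i) N = min (liminf l atTop) N := by
  obtain ⟨i₀, hi₀⟩ := eventually_atTop.1 (h N)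
  have hmono : Monotone fun i => min (l (i₀ + i)) (N : ℕ∞) :=
    monotone_nat_of_le_succ fun i => (hi₀ (i₀ + i) (by omega)).1
  -- A monotone sequence in the finite set of levels at most `N` is eventually constant.
  obtain ⟨m, hm⟩ : ∃ m : ℕ∞, ∀ᶠ i in atTop, min (l i) (N : ℕ∞) = m := by
    have hwf : WellFoundedGT (Set.Iic (N : ℕ∞)) := by
      have : Finite (Set.Iic (N : ℕ∞)) := by
        refine Set.Finite.subset ((Set.finite_Iic N).image ((↑) : ℕ → ℕ∞)) ?_
        intro x hx
        lift x to ℕ using ne_top_of_le_ne_top (ENat.natCast_ne_top N) hx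
        exact ⟨x, by simpa using hx, rfl⟩
      infer_instance
    let g : ℕ →o Set.Iic (N : ℕ∞) :=
      ⟨fun i => ⟨min (l (i₀ + i)) (N : ℕ∞), Set.mem_Iic.2 (min_le_right _ _)⟩,
        fun i j hij => hmono hij⟩
    obtain ⟨n, hn⟩ := WellFoundedGT.monotone_chain_condition g
    refine ⟨g n, eventually_atTop.2 ⟨i₀ + n, fun i hi => ?_⟩⟩
    have := congrArg Subtype.val (hn (i - i₀) (by omega))
    change min (l (i₀ + n)) (N : ℕ∞) = min (l (i₀ + (i - i₀))) (N : ℕ∞) at this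
    rw [show i₀ + (i - i₀) = i by omega] at this
    exact this.symm
  have hmN : m ≤ N := by
    obtain ⟨i, hi⟩ := hm.exists
    exact hi ▸ min_le_right _ _
  -- Below `N` the truncation is invisible, so the levels themselves are eventually `m`; at `N` only
  -- a lower bound is known, and it suffices.
  rcases hmN.lt_or_eq with hlt | rfl
  · have hl : ∀ᶠ i in atTop, l i = m := by
      filter_upwards [hm] with i hi
      rcases min_choice (l i) (N : ℕ∞) with h' | h' <;> rw [h'] at hi
      · exact hi
      · exact absurd hi.symm hlt.ne
    have : liminf l atTop = m := by
      rw [liminf_congr hl, liminf_const]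
    filter_upwards [hl] with i hi
    rw [hi, this]
  · have hl : ∀ᶠ i in atTop, (N : ℕ∞) ≤ l i := by
      filter_upwards [hm] with i hi
      exact min_eq_right_iff.1 hi
    have : (N : ℕ∞) ≤ liminf l atTop := le_liminf_of_le (by isBoundedDefault) hl
    filter_upwards [hl] with i hi
    rw [min_eq_right hi, min_eq_right this]

/-- An approximate code can be corrected to an exact one by changing its levels only, without
changing levels below `K`, and with asymptotically the same levels. -/
theorem exists_exact_levels {b : ℕ → Prop} {l : ℕ → ℕ∞} {K : ℕ}
    (hK : ∀ i, ApproxAt b l K i) (h : ∀ N, ∀ᶠ i in atTop, ApproxAt b l N i) :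
    ∃ L : ℕ → ℕ∞, Monotone L ∧
      (∀ i, b i → ∀ j : ℕ, 1 ≤ j → (j : ℕ∞) ≤ L i + 1 → ¬ b (i + j) ∧ L (i + j) = L i) ∧
      (∀ i, min (L i) K = min (l i) K) ∧
      ∀ N : ℕ, ∀ᶠ i in atTop, min (L i) N = min (l i) N := by
  classical
  set c := liminf l atTop with hc
  have hmonoK : Monotone fun i => min (l i) (K : ℕ∞) := monotone_nat_of_le_succ fun i => (hK i).1
  have hup : ∀ {i j}, i ≤ j → (K : ℕ∞) ≤ l i → (K : ℕ∞) ≤ l j := fun {i j} hij hi => by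
    have := hmonoK hij
    simp only [min_eq_right hi] at this
    exact this.trans (min_le_left _ _)
  let P : ℕ → ℕ → ℕ → Prop := fun i p q => (K : ℕ∞) ≤ l p ∧ p < q ∧ b p ∧ b q ∧ i < q
  -- A plus at `p` of level `m` forces minuses up to `p + m + 1`, so a plus at `q` allows exactly `m
  -- ≤ q - p - 2`. With no plus after `i` the infimum is `⊤` and imposes nothing.
  let J : ℕ → ℕ∞ := fun i => ⨅ (p) (q) (_ : P i p q), ((q - p - 2 : ℕ) : ℕ∞)
  have hJle : ∀ {i p q}, P i p q → J i ≤ ((q - p - 2 : ℕ) : ℕ∞) := fun {i p q} hp =>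
    iInf_le_of_le p (iInf_le_of_le q (iInf_le _ hp))
  have hleJ : ∀ {i} {a : ℕ∞}, (∀ p q, P i p q → a ≤ ((q - p - 2 : ℕ) : ℕ∞)) → a ≤ J i :=
    fun {i a} ha => le_iInf fun p => le_iInf fun q => le_iInf fun hp => ha p q hp
  have hgap : ∀ {N p q : ℕ}, ApproxAt b l N p → b p → b q → p < q →
      min (l p) N + 2 ≤ ((q - p : ℕ) : ℕ∞) := by
    intro N p q hN hp hq hpq
    by_contra hcon
    have hlt : ((q - p : ℕ) : ℕ∞) ≤ min (l p) N + 1 := by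
      have hne : min (l p) (N : ℕ∞) ≠ ⊤ :=
        ne_top_of_le_ne_top (ENat.natCast_ne_top N) (min_le_right _ _)
      generalize min (l p) (N : ℕ∞) = x at *
      lift x to ℕ using hne
      norm_cast at hcon ⊢
      omega
    refine (hN.2 hp (q - p) (by omega) hlt).1 ?_
    rwa [show p + (q - p) = q by omega]
  have hgap2 : ∀ {N p q : ℕ}, ApproxAt b l N p → b p → b q → p < q →
      min (l p) N ≤ ((q - p - 2 : ℕ) : ℕ∞) := by
    intro N p q hN hp hq hpq
    have := hgap hN hp hq hpq
    have hne : min (l p) (N : ℕ∞) ≠ ⊤ :=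
        ne_top_of_le_ne_top (ENat.natCast_ne_top N) (min_le_right _ _)
    generalize min (l p) (N : ℕ∞) = x at *
    lift x to ℕ using hne
    norm_cast at this ⊢
    omega
  have hKc : ∀ {i}, (K : ℕ∞) ≤ l i → (K : ℕ∞) ≤ c := fun {i} hi =>
    le_liminf_of_le (by isBoundedDefault) (eventually_atTop.2 ⟨i, fun j hj => hup hj hi⟩)
  have hKJ : ∀ i, (K : ℕ∞) ≤ J i := fun i => hleJ fun p q ⟨h1, h2, h3, h4, _⟩ => by
    simpa [min_eq_right h1] using hgap2 (hK p) h3 h4 h2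
  have hJmono : Monotone J := fun i i' hii => hleJ fun p q ⟨h1, h2, h3, h4, h5⟩ =>
    hJle ⟨h1, h2, h3, h4, lt_of_le_of_lt hii h5⟩
  let L : ℕ → ℕ∞ := fun i => if l i < K then l i else min c (J i)
  have hLlt : ∀ {i}, l i < K → L i = l i := fun hi => if_pos hi
  have hLge : ∀ {i}, (K : ℕ∞) ≤ l i → L i = min c (J i) := fun hi => if_neg (not_lt.2 hi)
  have hKL : ∀ {i}, (K : ℕ∞) ≤ l i → (K : ℕ∞) ≤ L i := fun hi => by
    rw [hLge hi]; exact le_min (hKc hi) (hKJ _)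
  refine ⟨L, fun i i' hii => ?_, fun i hbi j hj hjL => ?_, fun i => ?_, fun N => ?_⟩
  · rcases lt_or_ge (l i) K with hi | hi
    · rw [hLlt hi]
      rcases lt_or_ge (l i') K with hi' | hi'
      · rw [hLlt hi']
        have := hmonoK hii
        simpa [min_eq_left hi.le, min_eq_left hi'.le] using this
      · exact hi.le.trans (hKL hi')
    · rw [hLge hi, hLge (hup hii hi)]
      exact min_le_min_left _ (hJmono hii)
  · rcases lt_or_ge (l i) K with hi | hi
    · rw [hLlt hi] at hjL ⊢
      have h2 := (hK i).2 hbi j hj (by rwa [min_eq_left hi.le])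
      rw [min_eq_left hi.le] at h2
      have h3 : l (i + j) = l i := by
        rcases min_choice (l (i + j)) (K : ℕ∞) with h' | h' <;> rw [h'] at h2
        · exact h2.2
        · exact absurd h2.2.symm hi.ne
      exact ⟨h2.1, by rw [hLlt (h3 ▸ hi), h3]⟩
    -- A plus at `i + j'` would pair with the one at `i` and push `L i` down to `j' - 2`, too small
    -- for `j ≤ L i + 1`.
    · have hnb : ∀ j' : ℕ, 1 ≤ j' → j' ≤ j → ¬ b (i + j') := by
        intro j' hj' hjj hb
        have h1 : L i ≤ ((i + j' - i - 2 : ℕ) : ℕ∞) := by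
          rw [hLge hi]
          exact (min_le_right _ _).trans (hJle ⟨hi, by omega, hbi, hb, by omega⟩)
        have h2 := hgap (hK i) hbi hb (by omega)
        rw [min_eq_right hi] at h2
        have h3 : (j : ℕ∞) ≤ ((i + j' - i - 2 : ℕ) : ℕ∞) + 1 := hjL.trans (by gcongr)
        norm_cast at h2 h3
        omega
      refine ⟨hnb j hj le_rfl, ?_⟩
      rw [hLge hi, hLge (hup (by omega) hi)]
      congr 1
      -- No plus lies in `(i, i + j]`, so `J i` and `J (i + j)` range over the same pairs.
      refine le_antisymm (hleJ fun p q ⟨h1, h2, h3, h4, h5⟩ => hJle ⟨h1, h2, h3, h4, ?_⟩)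
        (hJmono (by omega))
      by_contra hq
      refine hnb (q - i) (by omega) (by omega) ?_
      rwa [show i + (q - i) = q by omega]
  · rcases lt_or_ge (l i) K with hi | hi
    · rw [hLlt hi]
    · rw [min_eq_right hi, min_eq_right (hKL hi)]
  · obtain ⟨i₀, hi₀⟩ := eventually_atTop.1 ((h N).and (eventually_min_eq_liminf h N))
    refine eventually_atTop.2 ⟨i₀ + N + 2, fun i hi => ?_⟩
    rcases lt_or_ge (l i) K with hiK | hiK
    · rw [hLlt hiK]
    · rw [hLge hiK, (hi₀ i (by omega)).2, ← hc]
      -- If `p < i₀`, the gap is long because `q > i ≥ i₀ + N + 2`; if `p ≥ i₀`, the rules up to `N`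
      -- hold at `p`, where the truncated level is already `min c N`.
      have : min c (N : ℕ∞) ≤ J i := hleJ fun p q ⟨h1, h2, h3, h4, h5⟩ => by
        rcases lt_or_ge p i₀ with hp | hp
        · refine (min_le_right _ _).trans ?_
          norm_cast
          omega
        · have := hgap2 (hi₀ p hp).1 h3 h4 h2
          rwa [(hi₀ p hp).2] at this
      rw [min_right_comm, min_eq_left this]

/-! ### Letters and levels -/

/-- The standing assumptions on the sequence `s_1, s_2, …`. -/
structure Admissible (s : ℕ → ℝ) : Prop where
  pos : 0 < s 1
  lt : ∀ k : ℕ, 1 ≤ k → s k < s (k + 1)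
  lim : Tendsto s atTop (𝓝 1)

/-- The absolute values of the letters of the alphabet, indexed by `ℕ∞`. -/
noncomputable def level (s : ℕ → ℝ) (k : ℕ∞) : ℝ := if k = ⊤ then 1 else s (k.toNat + 1)

@[simp] theorem level_top (s : ℕ → ℝ) : level s ⊤ = 1 := if_pos rfl

@[simp] theorem level_natCast (s : ℕ → ℝ) (n : ℕ) : level s n = s (n + 1) := by
  simp [level]

namespace Admissible

variable {s : ℕ → ℝ}

theorem strictMono_nat (hs : Admissible s) : StrictMono fun n => s (n + 1) :=
  strictMono_nat_of_lt_succ fun n => hs.lt (n + 1) (by omega)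

theorem lt_one (hs : Admissible s) (n : ℕ) : s (n + 1) < 1 :=
  (hs.strictMono_nat n.lt_succ_self).trans_le
    (hs.strictMono_nat.monotone.ge_of_tendsto ((tendsto_add_atTop_iff_nat 1).2 hs.lim) _)

theorem strictMono_level (hs : Admissible s) : StrictMono (level s) := by
  intro a b hab
  lift a to ℕ using hab.ne_top
  rcases eq_or_ne b ⊤ with rfl | hb
  · simpa using hs.lt_one a
  · lift b to ℕ using hb
    simpa using hs.strictMono_nat (show a < b by exact_mod_cast hab)

theorem le_level (hs : Admissible s) (k : ℕ∞) : s 1 ≤ level s k := by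
  rw [← zero_add 1, ← level_natCast s, Nat.cast_zero]
  exact hs.strictMono_level.monotone zero_le

theorem level_pos (hs : Admissible s) (k : ℕ∞) : 0 < level s k := hs.pos.trans_le (hs.le_level k)

theorem level_le_one (hs : Admissible s) (k : ℕ∞) : level s k ≤ 1 := by
  simpa using hs.strictMono_level.monotone (le_top : k ≤ ⊤)

/-- Finite levels are isolated in `ℕ∞`, so only continuity at `⊤` matters, and there it is $s_k \to
1$. -/
theorem continuous_level (hs : Admissible s) : Continuous (level s) := by
  refine continuous_iff_continuousAt.2 fun k => ?_
  rcases eq_or_ne k ⊤ with rfl | hk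
  · refine tendsto_order.2 ⟨fun a ha => ?_, fun a ha => ?_⟩
    · rw [level_top] at ha
      obtain ⟨n, hn⟩ := (((tendsto_add_atTop_iff_nat 1).2 hs.lim).eventually_const_lt ha).exists
      filter_upwards [Ioi_mem_nhds (ENat.natCast_lt_top n)] with m hm
      exact hn.trans (by simpa using hs.strictMono_level hm)
    · rw [level_top] at ha
      exact Eventually.of_forall fun m => (hs.level_le_one m).trans_lt ha
  · rw [ContinuousAt, ENat.nhds_eq_pure hk]
    exact tendsto_pure_nhds _ _

/-- Levels that agree up to `N` have values within `1 - s_{N+1}` of each other. -/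
theorem abs_level_sub_le (hs : Admissible s) {k k' : ℕ∞} {N : ℕ} (h : min k N = min k' N) :
    |level s k - level s k'| ≤ 1 - s (N + 1) := by
  have h1 := hs.lt_one N
  rcases lt_or_ge k N with hk | hk
  · rw [min_eq_left hk.le] at h
    rcases min_choice k' (N : ℕ∞) with h' | h' <;> rw [h'] at h
    · rw [h, sub_self, abs_zero]; linarith
    · exact absurd h hk.ne
  · rw [min_eq_right hk] at h
    have hk' : (N : ℕ∞) ≤ k' := min_eq_right_iff.1 h.symm
    have a1 := hs.strictMono_level.monotone hk
    have a2 := hs.strictMono_level.monotone hk'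
    have a3 := hs.level_le_one k
    have a4 := hs.level_le_one k'
    rw [level_natCast] at a1 a2
    rw [abs_le]
    constructor <;> linarith

end Admissible

/-- The letter with a given sign and a given level. -/
noncomputable def letter (s : ℕ → ℝ) (b : Bool) (k : ℕ∞) : ℝ := cond b (level s k) (-level s k)

@[simp] theorem letter_true (s : ℕ → ℝ) (k : ℕ∞) : letter s true k = level s k := rfl

@[simp] theorem letter_false (s : ℕ → ℝ) (k : ℕ∞) : letter s false k = -level s k := rfl

theorem abs_letter_sub (s : ℕ → ℝ) (b : Bool) (k k' : ℕ∞) :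
    |letter s b k - letter s b k'| = |level s k - level s k'| := by
  cases b
  · rw [letter_false, letter_false, neg_sub_neg, abs_sub_comm]
  · rfl

namespace Admissible

variable {s : ℕ → ℝ}

theorem abs_letter (hs : Admissible s) (b : Bool) (k : ℕ∞) : |letter s b k| = level s k := by
  cases b <;> simp [abs_of_pos (hs.level_pos k)]

theorem letter_inj (hs : Admissible s) {b b' : Bool} {k k' : ℕ∞} :
    letter s b k = letter s b' k' ↔ b = b' ∧ k = k' := by
  refine ⟨fun h => ?_, fun ⟨h1, h2⟩ => h1 ▸ h2 ▸ rfl⟩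
  have hk : k = k' := hs.strictMono_level.injective (by
    rw [← hs.abs_letter b k, ← hs.abs_letter b' k', h])
  have h1 := hs.level_pos k
  subst hk
  cases b <;> cases b' <;> simp at h ⊢ <;> linarith

theorem letter_mem_Icc (hs : Admissible s) (b : Bool) (k : ℕ∞) :
    letter s b k ∈ Set.Icc (-1 : ℝ) 1 :=
  abs_le.1 ((hs.abs_letter b k).trans_le (hs.level_le_one k))

theorem mem_alphabet_iff {a : ℝ} : a ∈ alphabet s ↔ ∃ b k, a = letter s b k := by
  constructor
  · rintro (((rfl | rfl) | ⟨k, hk, rfl⟩) | ⟨k, hk, rfl⟩)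
    · exact ⟨false, ⊤, by simp⟩
    · exact ⟨true, ⊤, by simp⟩
    · exact ⟨false, ((k - 1 : ℕ) : ℕ∞), by rw [letter_false, level_natCast, Nat.sub_add_cancel hk]⟩
    · exact ⟨true, ((k - 1 : ℕ) : ℕ∞), by rw [letter_true, level_natCast, Nat.sub_add_cancel hk]⟩
  · rintro ⟨b, k, rfl⟩
    rcases eq_or_ne k ⊤ with rfl | hk
    · cases b <;> simp [alphabet]
    · lift k to ℕ using hk
      cases b
      · exact Or.inl (Or.inr ⟨k + 1, by omega, by simp⟩)
      · exact Or.inr ⟨k + 1, by omega, by simp⟩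

/-- Nearby letters have the same sign, and the same level up to `N`. -/
theorem exists_separation (hs : Admissible s) (N : ℕ) : ∃ r : ℝ, 0 < r ∧ ∀ b b' k k',
    |letter s b k - letter s b' k'| < r → b = b' ∧ min k (N : ℕ∞) = min k' N := by
  -- The bound by `s 1` separates signs, since opposite letters are at least `2 * s 1` apart; the
  -- finitely many gaps separate the levels up to `N`.
  obtain ⟨r, hr, hr1, hrN⟩ : ∃ r : ℝ, 0 < r ∧ r ≤ s 1 ∧
      ∀ n < N, r ≤ s (n + 2) - s (n + 1) := by
    induction N with
    | zero => exact ⟨s 1, hs.pos, le_rfl, by simp⟩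
    | succ N ih =>
      obtain ⟨r, hr, hr1, hrN⟩ := ih
      refine ⟨min r (s (N + 2) - s (N + 1)), lt_min hr (sub_pos.2 (hs.lt _ (by omega))),
        (min_le_left _ _).trans hr1, fun n hn => ?_⟩
      rcases Nat.lt_succ_iff_lt_or_eq.1 hn with hn | rfl
      · exact (min_le_left _ _).trans (hrN n hn)
      · exact min_le_right _ _
  have key : ∀ k k' : ℕ∞, |level s k - level s k'| < r → min k' (N : ℕ∞) ≤ min k N := by
    intro k k' h
    by_contra! hlt
    have hkN : k < N := by
      by_contra! hk
      rw [min_eq_right hk] at hlt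
      exact (min_le_right _ _).not_gt hlt
    rw [min_eq_left hkN.le] at hlt
    have hkk : k < k' := hlt.trans_le (min_le_left _ _)
    lift k to ℕ using hkk.ne_top
    have h1 := hs.strictMono_level.monotone (ENat.natCast_add_one_le_iff.2 hkk)
    rw [← Nat.cast_succ, level_natCast] at h1
    have h2 := hrN k (by exact_mod_cast hkN)
    rw [level_natCast] at h
    have h3 := (abs_lt.1 h).1
    simp only [Nat.succ_eq_add_one] at h1
    linarith
  refine ⟨r, hr, fun b b' k k' h => ?_⟩
  have hb : b = b' := by
    have h1 := hs.le_level k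
    have h2 := hs.le_level k'
    have h3 := hs.pos
    have h4 := abs_lt.1 h
    cases b <;> cases b' <;> simp at h4 ⊢ <;> linarith
  subst hb
  rw [abs_letter_sub] at h
  exact ⟨rfl, le_antisymm (key _ _ (by rwa [abs_sub_comm])) (key _ _ h)⟩

end Admissible

/-! ### Codes of points -/

/-- The pairs of sequences of signs and of levels that code the points of the subshift. -/
def codes : Set ((ℕ → Bool) × (ℕ → ℕ∞)) :=
  {z | Monotone z.2 ∧ ∀ n, z.1 n = true → ∀ j : ℕ, 1 ≤ j → (j : ℕ∞) ≤ z.2 n + 1 →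
    z.1 (n + j) = false ∧ z.2 (n + j) = z.2 n}

theorem isClosed_codes : IsClosed codes := by
  have hb : ∀ (n : ℕ) (c : Bool), IsClosed {z : (ℕ → Bool) × (ℕ → ℕ∞) | z.1 n = c} := fun n c =>
    isClosed_eq (by fun_prop) continuous_const
  have hl : ∀ n : ℕ, Continuous fun z : (ℕ → Bool) × (ℕ → ℕ∞) => z.2 n := fun n => by fun_prop
  have heq : codes = (⋂ n : ℕ, {z | z.2 n ≤ z.2 (n + 1)}) ∩ ⋂ n : ℕ, ⋂ j : ℕ,
      ({z | z.1 n = false} ∪ {z | z.2 n + 2 ≤ ((j + 1 : ℕ) : ℕ∞)} ∪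
        ({z | z.1 (n + (j + 1)) = false} ∩ {z | z.2 (n + (j + 1)) = z.2 n})) := by
    ext z
    -- The negated premise is rewritten as a non-strict inequality, so that it defines a closed set;
    -- at `⊤` both sides fail.
    have hlt : ∀ n j : ℕ, z.2 n + 2 ≤ ((j + 1 : ℕ) : ℕ∞) ↔
        ¬ (((j + 1 : ℕ) : ℕ∞) ≤ z.2 n + 1) := by
      intro n j
      rcases eq_or_ne (z.2 n) ⊤ with h | h
      · simp [h]
      · lift z.2 n to ℕ using h with m
        norm_cast
        omega
    simp only [codes, Set.mem_inter_iff, Set.mem_iInter, Set.mem_ofPred_eq, Set.mem_union, hlt]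
    refine and_congr ⟨fun h n => h n.le_succ, monotone_nat_of_le_succ⟩
      (forall_congr' fun n => ⟨fun h j => ?_, fun h hn j hj hjl => ?_⟩)
    · by_cases h1 : z.1 n = true
      · by_cases h2 : ((j + 1 : ℕ) : ℕ∞) ≤ z.2 n + 1
        · exact Or.inr (h h1 (j + 1) (by omega) h2)
        · exact Or.inl (Or.inr h2)
      · exact Or.inl (Or.inl (by simpa using h1))
    · obtain ⟨j, rfl⟩ := Nat.exists_eq_add_of_le' hj
      rcases h j with (h | h) | h
      · simp [hn] at h
      · exact absurd hjl h
      · exact h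
  rw [heq]
  refine (isClosed_iInter fun n => isClosed_le (hl n) (hl _)).inter
    (isClosed_iInter fun n => isClosed_iInter fun j => ((hb _ _).union
      (isClosed_le ((hl n).add continuous_const) continuous_const)).union
      ((hb _ _).inter (isClosed_eq (hl _) (hl _))))

/-- The sequence of letters coded by a sequence of signs and a sequence of levels. -/
noncomputable def decode (s : ℕ → ℝ) (z : (ℕ → Bool) × (ℕ → ℕ∞)) : SeqSpace := fun n =>
  -- For admissible `s` every letter lies in the interval and the projection changes nothing.
  Set.projIcc (-1 : ℝ) 1 (by norm_num) (letter s (z.1 n) (z.2 n))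

namespace Admissible

variable {s : ℕ → ℝ}

theorem coord_decode (hs : Admissible s) (z : (ℕ → Bool) × (ℕ → ℕ∞)) (n : ℕ) :
    (decode s z).coord n = letter s (z.1 n) (z.2 n) := by
  unfold decode SeqSpace.coord
  beta_reduce
  rw [Set.projIcc_of_mem _ (hs.letter_mem_Icc _ _)]

theorem decode_mem_subshift (hs : Admissible s) {z : (ℕ → Bool) × (ℕ → ℕ∞)} (hz : z ∈ codes) :
    decode s z ∈ subshift s := by
  refine ⟨fun n => ?_, fun n => ?_, fun n k hk hn j hj hjk => ?_, fun n hn j hj => ?_⟩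
  · rw [hs.coord_decode]; exact mem_alphabet_iff.2 ⟨_, _, rfl⟩
  · rw [hs.coord_decode, hs.coord_decode, hs.abs_letter, hs.abs_letter]
    exact hs.strictMono_level.monotone (hz.1 n.le_succ)
  · obtain ⟨k, rfl⟩ := Nat.exists_eq_add_of_le' hk
    rw [hs.coord_decode, ← level_natCast s, ← letter_true, hs.letter_inj] at hn
    obtain ⟨h1, h2⟩ := hz.2 n hn.1 j hj (by rw [hn.2]; exact_mod_cast hjk)
    rw [hs.coord_decode, h1, h2, hn.2, letter_false, level_natCast]
  · rw [hs.coord_decode, ← level_top s, ← letter_true, hs.letter_inj] at hn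
    obtain ⟨h1, h2⟩ := hz.2 n hn.1 j hj (by rw [hn.2]; simp)
    rw [hs.coord_decode, h1, h2, hn.2, letter_false, level_top]

theorem exists_code (hs : Admissible s) {x : SeqSpace} (hx : x ∈ subshift s) :
    ∃ z ∈ codes, decode s z = x := by
  obtain ⟨h1, h2, h3, h4⟩ := hx
  choose b k hbk using fun n => mem_alphabet_iff.1 (h1 n)
  refine ⟨(b, k), ⟨monotone_nat_of_le_succ fun n => ?_, fun n hn j hj hjk => ?_⟩, ?_⟩
  · have := h2 n
    rw [hbk, hbk, hs.abs_letter, hs.abs_letter] at this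
    exact hs.strictMono_level.le_iff_le.1 this
  · change b n = true at hn
    change (j : ℕ∞) ≤ k n + 1 at hjk
    change b (n + j) = false ∧ k (n + j) = k n
    rw [← hs.letter_inj, ← hbk, letter_false]
    have hn' : x.coord n = level s (k n) := by rw [hbk, hn, letter_true]
    rcases eq_or_ne (k n) ⊤ with h | h
    · rw [h, level_top] at hn' ⊢
      exact h4 n hn' j hj
    · lift k n to ℕ using h with m
      rw [level_natCast] at hn' ⊢
      exact h3 n (m + 1) (by omega) hn' j hj (by exact_mod_cast hjk)
  · funext n
    apply Subtype.ext
    exact (hs.coord_decode _ n).trans (hbk n).symm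

end Admissible

/-! ### The metric -/

/-- Coordinates from position `N` on contribute at most $2 \cdot 2^{-(N+1)} = 2^{-N}$. -/
theorem seqDist_le_of_forall_lt {x y : SeqSpace} {N : ℕ} {ε : ℝ} (hN : (1 / 2 : ℝ) ^ N ≤ ε)
    (h : ∀ n < N, |x.coord n - y.coord n| ≤ ε) : seqDist x y ≤ ε := by
  refine ciSup_le fun n => ?_
  have h0 := abs_nonneg (x.coord n - y.coord n)
  rcases lt_or_ge n N with hn | hn
  · have h1 : (1 / 2 : ℝ) ^ (n + 1) ≤ 1 := pow_le_one₀ (by norm_num) (by norm_num)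
    exact (mul_le_of_le_one_left h0 h1).trans (h n hn)
  · have h1 : (1 / 2 : ℝ) ^ n ≤ (1 / 2 : ℝ) ^ N :=
      pow_le_pow_of_le_one (by norm_num) (by norm_num) hn
    have h2 := SeqSpace.abs_coord_sub_le x y n
    have h3 : (0 : ℝ) ≤ (1 / 2 : ℝ) ^ n := by positivity
    rw [pow_succ]
    nlinarith

theorem abs_coord_sub_le_mul_seqDist (x y : SeqSpace) (n : ℕ) :
    |x.coord n - y.coord n| ≤ 2 ^ (n + 1) * seqDist x y := by
  have h := mul_le_mul_of_nonneg_left (le_seqDist x y n) (by positivity : (0 : ℝ) ≤ 2 ^ (n + 1))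
  rwa [← mul_assoc, ← mul_pow, show (2 : ℝ) * (1 / 2) = 1 by norm_num, one_pow, one_mul] at h

theorem continuous_coord (n : ℕ) : Continuous fun x : SeqSpace => x.coord n := by
  refine (LipschitzWith.of_dist_le_mul (K := 2 ^ (n + 1)) fun x y => ?_).continuous
  rw [Real.dist_eq]
  exact_mod_cast abs_coord_sub_le_mul_seqDist x y n

theorem exists_half_pow_le {ε : ℝ} (hε : 0 < ε) : ∃ N : ℕ, (1 / 2 : ℝ) ^ N ≤ ε :=
  (exists_pow_lt_of_lt_one hε (by norm_num)).imp fun _ h => h.le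

theorem continuous_of_continuous_coord {Z : Type*} [TopologicalSpace Z] {F : Z → SeqSpace}
    (h : ∀ n, Continuous fun z => (F z).coord n) : Continuous F := by
  refine continuous_iff_continuousAt.2 fun z => Metric.tendsto_nhds.2 fun ε hε => ?_
  obtain ⟨N, hN⟩ := exists_half_pow_le (half_pos hε)
  have : ∀ᶠ w in 𝓝 z, ∀ n ∈ Set.Iio N, dist ((F w).coord n) ((F z).coord n) < ε / 2 :=
    (Filter.eventually_all_finite (Set.finite_Iio N)).2 fun n _ =>
      Metric.tendsto_nhds.1 (h n).continuousAt _ (half_pos hε)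
  filter_upwards [this] with w hw
  exact (seqDist_le_of_forall_lt hN fun n hn => (hw n hn).le).trans_lt (half_lt_self hε)

theorem continuous_shift : Continuous shift :=
  continuous_of_continuous_coord fun n => continuous_coord (n + 1)

theorem Admissible.continuous_decode {s : ℕ → ℝ} (hs : Admissible s) :
    Continuous (decode s) := by
  refine continuous_of_continuous_coord fun n => ?_
  simp only [hs.coord_decode]
  have hlet : Continuous fun p : Bool × ℕ∞ => letter s p.1 p.2 :=
    continuous_prod_of_discrete_left.2 fun b => by
      cases b
      · exact hs.continuous_level.neg
      · exact hs.continuous_level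
  exact hlet.comp (f := fun z : (ℕ → Bool) × (ℕ → ℕ∞) => (z.1 n, z.2 n)) (by fun_prop)

theorem Admissible.isCompact_subshift {s : ℕ → ℝ} (hs : Admissible s) :
    IsCompact (subshift s) := by
  have : subshift s = Set.image (decode s) codes := by
    ext x
    exact ⟨fun hx => hs.exists_code hx, fun ⟨z, hz, h⟩ => h ▸ hs.decode_mem_subshift hz⟩
  rw [this]
  exact isClosed_codes.isCompact.image hs.continuous_decode

theorem continuous_subshiftMap (s : ℕ → ℝ) : Continuous (subshiftMap s) :=
  continuous_shift.restrict (mapsTo_shift s)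

/-! ### Shadowing -/

theorem coord_iterate_subshiftMap (s : ℕ → ℝ) (x : subshift s) (i n : ℕ) :
    ((subshiftMap s)^[i] x : SeqSpace).coord n = (x : SeqSpace).coord (n + i) := by
  induction i generalizing x with
  | zero => rfl
  | succ i ih =>
    rw [Function.iterate_succ_apply, ih]
    rfl

/-- Along a pseudo-orbit, the coordinates of a point are close to the initial coordinates of the
following points. -/
theorem abs_coord_sub_coord_zero_le {ξ : ℕ → SeqSpace} {η : ℝ} {i : ℕ}
    (h : ∀ j, i ≤ j → seqDist (shift (ξ j)) (ξ (j + 1)) ≤ η) (n : ℕ) :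
    |(ξ i).coord n - (ξ (i + n)).coord 0| ≤ 2 ^ (n + 1) * η := by
  have hη : 0 ≤ η := (dist_nonneg (x := shift (ξ i))).trans (h i le_rfl)
  induction n generalizing i with
  | zero => simpa using hη
  | succ n ih =>
    have h1 := ih (i := i + 1) fun j hj => h j (by omega)
    have h2 := (abs_coord_sub_le_mul_seqDist (shift (ξ i)) (ξ (i + 1)) n).trans
      (mul_le_mul_of_nonneg_left (h i le_rfl) (by positivity))
    change |(ξ i).coord (n + 1) - (ξ (i + 1)).coord n| ≤ _ at h2
    rw [show i + 1 + n = i + (n + 1) by omega] at h1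
    have h3 := abs_sub_le ((ξ i).coord (n + 1)) ((ξ (i + 1)).coord n) ((ξ (i + (n + 1))).coord 0)
    rw [pow_succ 2 (n + 1)]
    linarith

/-- The initial coordinates of a pseudo-orbit with small errors obey the rules of the subshift
approximately. -/
theorem Admissible.exists_approxAt {s : ℕ → ℝ} (hs : Admissible s) (N : ℕ) :
    ∃ η : ℝ, 0 < η ∧ ∀ (ξ : ℕ → SeqSpace) (z : ℕ → (ℕ → Bool) × (ℕ → ℕ∞)),
      (∀ i, z i ∈ codes ∧ decode s (z i) = ξ i) → ∀ i,
      (∀ j, i ≤ j → seqDist (shift (ξ j)) (ξ (j + 1)) ≤ η) →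
      ApproxAt (fun i => (z i).1 0 = true) (fun i => (z i).2 0) N i := by
  obtain ⟨r, hr, hsep⟩ := hs.exists_separation N
  -- The rules up to `N` look at most `N + 1` positions ahead, where the error has grown by at most
  -- $2^{N+2}$.
  refine ⟨r / 2 ^ (N + 3), by positivity, fun ξ z hz i hi => ?_⟩
  have key : ∀ n ≤ N + 1, (z i).1 n = (z (i + n)).1 0 ∧
      min ((z i).2 n) (N : ℕ∞) = min ((z (i + n)).2 0) N := by
    intro n hn
    refine hsep _ _ _ _ ?_
    have h := abs_coord_sub_coord_zero_le hi n
    rw [← (hz i).2, ← (hz (i + n)).2, hs.coord_decode, hs.coord_decode] at h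
    refine h.trans_lt ?_
    have h2 : (2 : ℝ) ^ (n + 1) < 2 ^ (N + 3) := pow_lt_pow_right₀ (by norm_num) (by omega)
    rw [mul_div_assoc', div_lt_iff₀ (by positivity), mul_comm]
    exact mul_lt_mul_of_pos_left h2 hr
  refine ⟨?_, fun hb j hj hjl => ?_⟩
  · rw [← (key 1 (by omega)).2]
    exact min_le_min_right _ ((hz i).1.1 zero_le_one)
  · have hjN : j ≤ N + 1 := by
      have : (j : ℕ∞) ≤ N + 1 := hjl.trans (by gcongr; exact min_le_right _ _)
      exact_mod_cast this
    have h := (hz i).1.2 0 hb j hj (hjl.trans (by gcongr; exact min_le_left _ _))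
    rw [zero_add] at h
    have hk := key j hjN
    rw [h.1, h.2] at hk
    exact ⟨by simp [← hk.1], hk.2.symm⟩

/-- A point whose coordinates follow the initial coordinates of a pseudo-orbit shadows it. -/
theorem seqDist_iterate_le {s : ℕ → ℝ} {x : subshift s} {ξ : ℕ → subshift s} {ε δ : ℝ} {N i : ℕ}
    (hN : (1 / 2 : ℝ) ^ N ≤ ε) (hδ : δ ≤ ε / 2 ^ (N + 1))
    (h : ∀ j, i ≤ j → dist (subshiftMap s (ξ j)) (ξ (j + 1)) ≤ δ)
    (hx : ∀ j, i ≤ j → |(x : SeqSpace).coord j - (ξ j : SeqSpace).coord 0| ≤ ε / 2) :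
    dist ((subshiftMap s)^[i] x) (ξ i) ≤ ε := by
  have hε : 0 < ε := lt_of_lt_of_le (by positivity) hN
  refine seqDist_le_of_forall_lt hN fun n hn => ?_
  have h1 := abs_coord_sub_coord_zero_le (ξ := fun j => (ξ j : SeqSpace)) h n
  have h2 := hx (i + n) (by omega)
  rw [coord_iterate_subshiftMap, add_comm n i]
  have h3 : 2 ^ (n + 1) * δ ≤ ε / 2 := by
    have h4 : (2 : ℝ) ^ (n + 1) ≤ 2 ^ N := pow_le_pow_right₀ (by norm_num) (by omega)
    calc 2 ^ (n + 1) * δ ≤ 2 ^ (n + 1) * (ε / 2 ^ (N + 1)) := by gcongr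
      _ ≤ 2 ^ N * (ε / 2 ^ (N + 1)) := by gcongr
      _ = ε / 2 := by rw [pow_succ]; field_simp
  have h5 := abs_sub_le ((x : SeqSpace).coord (i + n)) ((ξ (i + n) : SeqSpace).coord 0)
    ((ξ i : SeqSpace).coord n)
  rw [abs_sub_comm ((ξ (i + n) : SeqSpace).coord 0)] at h5
  linarith

theorem Admissible.exists_one_sub_le {s : ℕ → ℝ} (hs : Admissible s) {ε : ℝ} (hε : 0 < ε) :
    ∃ K : ℕ, 1 - s (K + 1) ≤ ε := by
  obtain ⟨K, hK⟩ := (((tendsto_add_atTop_iff_nat 1).2 hs.lim).eventually_const_lt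
    (sub_lt_self 1 hε)).exists
  exact ⟨K, by linarith⟩

theorem Admissible.hasSLimitShadowing {s : ℕ → ℝ} (hs : Admissible s) :
    HasSLimitShadowing (subshiftMap s) := by
  intro ε hε
  obtain ⟨K, hK⟩ := hs.exists_one_sub_le (half_pos hε)
  obtain ⟨N, hN⟩ := exists_half_pow_le hε
  obtain ⟨η, hη, hη'⟩ := hs.exists_approxAt K
  -- The first bound gives the rules up to `K`; the second keeps the accumulated drift over `N`
  -- coordinates below `ε / 2`, the other half being spent on altering levels.
  refine ⟨min η (ε / 2 ^ (N + 1)), lt_min hη (by positivity), fun ξ hξ => ?_⟩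
  have hev : ∀ δ : ℝ, 0 < δ → ∃ i₀, ∀ i, i₀ ≤ i → ∀ j, i ≤ j →
      dist (subshiftMap s (ξ j)) (ξ (j + 1)) ≤ δ := fun δ hδ => by
    obtain ⟨i₀, h⟩ := eventually_atTop.1 (hξ.2.eventually_le_const hδ)
    exact ⟨i₀, fun i hi j hj => h j (hi.trans hj)⟩
  choose z hz using fun i => hs.exists_code (ξ i).2
  obtain ⟨L, hLmono, hLrule, hLK, hLN⟩ := exists_exact_levels
    (fun i => hη' (fun i => ξ i) z hz i fun j _ => (hξ.1 j).trans (min_le_left _ _))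
    (fun M => by
      obtain ⟨θ, hθ, hθ'⟩ := hs.exists_approxAt M
      obtain ⟨i₀, hi₀⟩ := hev θ hθ
      exact eventually_atTop.2 ⟨i₀, fun i hi => hθ' (fun i => ξ i) z hz i (hi₀ i hi)⟩)
  have hmem : (fun i => (z i).1 0, L) ∈ codes :=
    ⟨hLmono, fun n hn j hj hjL => by simpa using hLrule n hn j hj hjL⟩
  have hclose : ∀ (M i : ℕ), min (L i) (M : ℕ∞) = min ((z i).2 0) M →
      |(decode s (fun i => (z i).1 0, L)).coord i - (ξ i : SeqSpace).coord 0| ≤ 1 - s (M + 1) := by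
    intro M i h
    rw [← (hz i).2, hs.coord_decode, hs.coord_decode, abs_letter_sub]
    exact hs.abs_level_sub_le h
  refine ⟨⟨_, hs.decode_mem_subshift hmem⟩, fun i => ?_, ?_⟩
  · exact seqDist_iterate_le hN (min_le_right _ _) (fun j _ => hξ.1 j)
      fun j _ => (hclose K j (hLK j)).trans hK
  · refine Metric.tendsto_atTop.2 fun ε' hε' => ?_
    -- The tail is shadowed within `ε' / 2`, to get a strict bound by `ε'`; half of that again is
    -- the allowance for altered levels.
    obtain ⟨M, hM⟩ := hs.exists_one_sub_le (half_pos (half_pos hε'))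
    obtain ⟨N', hN'⟩ := exists_half_pow_le (half_pos hε')
    obtain ⟨i₀, hi₀⟩ := hev (ε' / 2 / 2 ^ (N' + 1)) (by positivity)
    obtain ⟨i₁, hi₁⟩ := eventually_atTop.1 (hLN M)
    refine ⟨max i₀ i₁, fun i hi => ?_⟩
    rw [Real.dist_0_eq_abs, abs_of_nonneg dist_nonneg]
    exact (seqDist_iterate_le hN' le_rfl (hi₀ i (le_of_max_le_left hi)) fun j hj =>
      (hclose M j (hi₁ j ((le_of_max_le_right hi).trans hj))).trans hM).trans_lt
        (half_lt_self hε')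

end SLimit

theorem mainTheorem8 (s : ℕ → ℝ) (hs_pos : 0 < s 1) (hs_lt : ∀ k : ℕ, 1 ≤ k → s k < s (k + 1))
    (hs_lim : Filter.Tendsto s Filter.atTop (nhds 1)) :
    IsCompact (SLimit.subshift s) ∧ Continuous (SLimit.subshiftMap s) ∧
      SLimit.HasSLimitShadowing (SLimit.subshiftMap s) := by
  have hs : SLimit.Admissible s := ⟨hs_pos, hs_lt, hs_lim⟩
  exact ⟨hs.isCompact_subshift, SLimit.continuous_subshiftMap s, hs.hasSLimitShadowing⟩
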